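/- Let $H_{\rm B},H_{\rm E},\sigma_{\rm B},\sigma_{\rm E},\varsigma_{\rm B},\varsigma_{\rm E},P>0$ and $\xi\in(0,1]$. For $k\in\{{\rm B},{\rm E}\}$ consider the channel $$Y_k=H_kX+\sqrt{H_kX}\,Z_{k,1}+Z_{k,0},\qquad Z_{k,1}\sim\mathcal N(0,\varsigma_k^2\sigma_k^2),\quad Z_{k,0}\sim\mathcal N(0,\sigma_k^2),$$ where $X$, $Z_{k,1}$, $Z_{k,0}$ are independent; $Y_{\rm B}$ is the output of the legitimate receiver and $Y_{\rm E}$ that of the eavesdropper. Let the secrecy capacity under the non-negativity and average-intensity constraints be $$C_{\rm s}=\sup\,\bigl[I(X;Y_{\rm B})-I(X;Y_{\rm E})\bigr]$$ (mutual information in nats), the supremum being over all laws of random variables $X\ge 0$ with $E[X]=\xi P$. Then $C_{\rm s}\ge C_{\rm Low}$, where $$\begin{aligned}C_{\rm Low}={}&\frac12\ln\left[\frac{e\,\xi^2P^2\sigma_{\rm E}^2}{2\pi\sigma_{\rm B}^2\left(H_{\rm E}^2\xi^2P^2+H_{\rm E}\xi P\varsigma_{\rm E}^2\sigma_{\rm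 E}^2+\sigma_{\rm E}^2\right)}\right]+f_{\rm low}(H_{\rm B},\xi,P)\\&+\frac12\left[e^{\frac{1}{H_{\rm B}\varsigma_{\rm B}^2\xi P}}\,\mathrm{Ei}\left(-\frac{1}{H_{\rm B}\varsigma_{\rm B}^2\xi P}\right)-e^{\frac{1}{H_{\rm E}\varsigma_{\rm E}^2\xi P}}\,\mathrm{Ei}\left(-\frac{1}{H_{\rm E}\varsigma_{\rm E}^2\xi P}\right)\right],\end{aligned}$$ $$f_{\rm low}(H_{\rm B},\xi,P)=\frac12\ln\left(H_{\rm B}^2+\frac{2H_{\rm B}\varsigma_{\rm B}^2\sigma_{\rm B}^2}{\xi P}\right)-\frac{H_{\rm B}\xi P+\varsigma_{\rm B}^2\sigma_{\rm B}^2}{\varsigma_{\rm B}^2\sigma_{\rm B}^2}+\frac{\sqrt{H_{\rm B}\xi P\left(H_{\rm B}\xi P+2\varsigma_{\rm B}^2\sigma_{\rm B}^2\right)}}{\varsigma_{\rm B}^2\sigma_{\rm B}^2},$$ and $\mathrm{Ei}(x)=\int_{-\infty}^x \frac{e^t}{t}\,{\rm d}t$ for $x<0$. The same lower bound holds if the supremum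 is restricted to those $X$ that have a probability density function. -/

import Mathlib

open MeasureTheory ProbabilityTheory InformationTheory

noncomputable section

namespace VLC

/-- The mutual information, in nats, of a pair of real random variables with joint law `ρ`:
the relative entropy of `ρ` with respect to the product of its marginals. -/
def mutualInfo (ρ : Measure (ℝ × ℝ)) : ENNReal :=
  klDiv ρ (ρ.fst.prod ρ.snd)

/-- The law of the pair `(Z₁, Z₀)` of independent noises with `Z₁ ∼ N(0, ς²σ²)` (to be scaled by
the signal) and `Z₀ ∼ N(0, σ²)` (independent of the signal). -/
def noiseLaw (σ ς : ℝ) : Measure (ℝ × ℝ) :=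
  (gaussianReal 0 (Real.toNNReal (ς ^ 2 * σ ^ 2))).prod (gaussianReal 0 (Real.toNNReal (σ ^ 2)))

/-- The joint law of `(X, Y)`, where `Y = H X + √(H X) Z₁ + Z₀`, the input `X` has law `μ`, and
`X`, `Z₁`, `Z₀` are independent. -/
def inputOutputLaw (H σ ς : ℝ) (μ : Measure ℝ) : Measure (ℝ × ℝ) :=
  (μ.prod (noiseLaw σ ς)).map
    (fun w : ℝ × (ℝ × ℝ) => (w.1, H * w.1 + √(H * w.1) * w.2.1 + w.2.2))

/-- The admissible input laws: laws of random variables `X ≥ 0` with `E[X] = m`. -/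
def inputLaws (m : ℝ) : Set (Measure ℝ) :=
  {μ | IsProbabilityMeasure μ ∧ (∀ᵐ x ∂μ, 0 ≤ x) ∧ Integrable (fun x : ℝ => x) μ ∧ ∫ x, x ∂μ = m}

/-- The admissible input laws that have a probability density function. -/
def inputLawsWithDensity (m : ℝ) : Set (Measure ℝ) :=
  {μ | μ ∈ inputLaws m ∧ μ ≪ volume}

/-- The supremum of `I(X; Y_B) - I(X; Y_E)` over the input laws in `S`. -/
def maxSecrecyRate (H_B σ_B ς_B H_E σ_E ς_E : ℝ) (S : Set (Measure ℝ)) : EReal :=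
  ⨆ μ ∈ S, ((mutualInfo (inputOutputLaw H_B σ_B ς_B μ) : EReal)
    - (mutualInfo (inputOutputLaw H_E σ_E ς_E μ) : EReal))

/-- The secrecy capacity of the wiretap channel under the constraints `X ≥ 0` and `E[X] = m`. -/
def secrecyCapacity (H_B σ_B ς_B H_E σ_E ς_E m : ℝ) : EReal :=
  maxSecrecyRate H_B σ_B ς_B H_E σ_E ς_E (inputLaws m)

/-- The exponential integral `Ei(x) = ∫_{-∞}^x e^t / t dt`, for `x < 0`. -/
def Ei (x : ℝ) : ℝ :=
  ∫ t in Set.Iic x, Real.exp t / t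

/-- The function `f_low(H_B, ξ, P)`. -/
def fLow (H_B σ_B ς_B ξ P : ℝ) : ℝ :=
  1 / 2 * Real.log (H_B ^ 2 + 2 * H_B * ς_B ^ 2 * σ_B ^ 2 / (ξ * P))
    - (H_B * ξ * P + ς_B ^ 2 * σ_B ^ 2) / (ς_B ^ 2 * σ_B ^ 2)
    + √(H_B * ξ * P * (H_B * ξ * P + 2 * ς_B ^ 2 * σ_B ^ 2)) / (ς_B ^ 2 * σ_B ^ 2)

/-- The closed form `C_Low`. -/
def cLow (H_B σ_B ς_B H_E σ_E ς_E ξ P : ℝ) : ℝ :=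
  1 / 2 * Real.log (Real.exp 1 * ξ ^ 2 * P ^ 2 * σ_E ^ 2 /
      (2 * Real.pi * σ_B ^ 2 *
        (H_E ^ 2 * ξ ^ 2 * P ^ 2 + H_E * ξ * P * ς_E ^ 2 * σ_E ^ 2 + σ_E ^ 2)))
    + fLow H_B σ_B ς_B ξ P
    + 1 / 2 *
      (Real.exp (1 / (H_B * ς_B ^ 2 * ξ * P)) * Ei (-(1 / (H_B * ς_B ^ 2 * ξ * P)))
        - Real.exp (1 / (H_E * ς_E ^ 2 * ξ * P)) * Ei (-(1 / (H_E * ς_E ^ 2 * ξ * P))))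

end VLC

end

namespace VLC

open Set Filter Topology

/-! ### Moments, transforms and logarithmic integrals of the exponential law -/

section Exponential

variable {r : ℝ}

/-! Every admissible input law bounds the supremum from below. The one used is the exponential law
of mean `m = ξ * P`; it has a density, so it serves both suprema.

For each receiver the mutual information is the output entropy minus the entropy of the output given
the input (`coe_mutualInfo_inputOutputLaw`). Given `X = x ≥ 0` the output is Gaussian with variance
`σ ^ 2 * (1 + H * ς ^ 2 * x)`, so the conditional entropy is exact: it only needs the mean of `log
(1 + H * ς ^ 2 * X)`, which is where `Ei` enters (`integral_log_one_add_expMeasure`).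

Only the two output entropies are estimated. The eavesdropper's is at most that of a Gaussian of
equal variance (`neg_log_variance_le_integral_log_outputPDF`). The legitimate receiver's does not
increase when `Z₀` is dropped (`integral_log_outputPDF_le`), and what remains, `H X + √(H X) Z₁`,
has an explicit asymmetric Laplace law, identified by its characteristic function
(`map_expMeasure_prod_gaussianReal`). The logarithm of that density is affine in `y` and `|y|`, and
`E|V| ≥ E V` turns its mean into the closed form.

Both entropy comparisons, and the lower bound that makes the log output density integrable, are
instances of Gibbs' inequality (`integral_le_integral_of_lintegral_exp_sub_le_one`). -/

lemma expMeasure_eq_withDensity (r : ℝ) :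
    expMeasure r =
      (volume.restrict (Ioi 0)).withDensity fun x => ENNReal.ofReal (r * Real.exp (-(r * x))) := by
  rw [← withDensity_indicator measurableSet_Ioi]
  refine withDensity_congr_ae ?_
  have h0 : ∀ᵐ x : ℝ, x ≠ 0 := by simp [ae_iff]
  filter_upwards [h0] with x hx
  by_cases h : 0 < x
  · rw [indicator_of_mem (mem_Ioi.2 h)]
    exact exponentialPDF_of_nonneg h.le
  · rw [indicator_of_notMem (by simpa using h)]
    exact exponentialPDF_of_neg (lt_of_le_of_ne (not_lt.1 h) hx)

lemma expMeasure_absolutelyContinuous (r : ℝ) : expMeasure r ≪ volume := by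
  rw [expMeasure_eq_withDensity]
  exact (withDensity_absolutelyContinuous _ _).trans Measure.absolutelyContinuous_restrict

lemma ae_expMeasure_pos (r : ℝ) : ∀ᵐ x ∂expMeasure r, 0 < x := by
  rw [expMeasure_eq_withDensity]
  exact (withDensity_absolutelyContinuous _ _).ae_le (ae_restrict_mem measurableSet_Ioi)

lemma integrable_expMeasure_iff {E : Type*} [NormedAddCommGroup E] [NormedSpace ℝ E]
    (hr : 0 < r) (g : ℝ → E) : Integrable g (expMeasure r) ↔
      IntegrableOn (fun x => (r * Real.exp (-(r * x))) • g x) (Ioi 0) := by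
  rw [expMeasure_eq_withDensity,
    integrable_withDensity_iff_integrable_smul₀' (by fun_prop) (by simp), IntegrableOn]
  refine integrable_congr (ae_of_all _ fun x => ?_)
  simp only
  rw [ENNReal.toReal_ofReal (by positivity)]

lemma integral_expMeasure {E : Type*} [NormedAddCommGroup E] [NormedSpace ℝ E]
    (hr : 0 < r) (g : ℝ → E) : ∫ x, g x ∂expMeasure r =
      ∫ x in Ioi 0, (r * Real.exp (-(r * x))) • g x := by
  rw [expMeasure_eq_withDensity,
    integral_withDensity_eq_integral_toReal_smul₀ (by fun_prop) (by simp)]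
  refine integral_congr_ae (ae_of_all _ fun x => ?_)
  simp only
  rw [ENNReal.toReal_ofReal (by positivity)]

lemma integrable_pow_expMeasure (hr : 0 < r) (n : ℕ) :
    Integrable (fun x => x ^ n) (expMeasure r) := by
  rw [integrable_expMeasure_iff hr]
  have h := (integrableOn_rpow_mul_exp_neg_mul_rpow (s := n) (p := 1) (b := r)
    (by have := n.cast_nonneg (α := ℝ); linarith) one_pos hr).const_mul r
  refine h.congr (ae_of_all _ fun x => ?_)
  simp only [Real.rpow_natCast, Real.rpow_one, smul_eq_mul, neg_mul]
  ring

lemma integral_pow_expMeasure (hr : 0 < r) (n : ℕ) :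
    ∫ x, x ^ n ∂expMeasure r = n.factorial / r ^ n := by
  rw [integral_expMeasure hr]
  have h := Real.integral_rpow_mul_exp_neg_mul_Ioi (a := n + 1) (r := r) (by positivity) hr
  rw [Real.Gamma_nat_eq_factorial] at h
  simp only [add_sub_cancel_right, Real.rpow_natCast] at h
  have : ∀ x : ℝ, (r * Real.exp (-(r * x))) • x ^ n = r * (x ^ n * Real.exp (-(r * x))) := by
    intro x; simp only [smul_eq_mul]; ring
  simp_rw [this]
  rw [integral_const_mul, h, show ((n : ℝ) + 1) = ((n + 1 : ℕ) : ℝ) by push_cast; ring,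
    Real.rpow_natCast, one_div, inv_pow, pow_succ]
  field_simp

/-- Complex `c` is needed because conditioning on the exponential variable leaves `c = H * (i t - s
t ^ 2 / 2)` in the characteristic function of the signal-dependent part. -/
lemma integral_cexp_expMeasure (hr : 0 < r) {c : ℂ} (hc : c.re ≤ 0) :
    ∫ x, Complex.exp (c * x) ∂expMeasure r = r / (r - c) := by
  have hre : (c - r).re < 0 := by simp; linarith
  rw [integral_expMeasure hr]
  have : ∀ x : ℝ, (r * Real.exp (-(r * x))) • Complex.exp (c * x) =
      r * Complex.exp ((c - r) * x) := by
    intro x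
    rw [Complex.real_smul]
    push_cast
    rw [mul_assoc, ← Complex.exp_add]
    congr 2; ring
  simp_rw [this]
  rw [integral_const_mul, integral_exp_mul_complex_Ioi hre]
  have h1 : c - r ≠ 0 := fun h => by simp [h] at hre
  have h2 : (r : ℂ) - c ≠ 0 := fun h => h1 (by rw [← neg_sub, h, neg_zero])
  simp only [Complex.ofReal_zero, mul_zero, Complex.exp_zero]
  rw [← neg_sub (r : ℂ) c]
  field_simp

lemma integrable_log_one_add_expMeasure (hr : 0 < r) {b : ℝ} (hb : 0 < b) :
    Integrable (fun x => Real.log (1 + b * x)) (expMeasure r) := by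
  have h := (integrable_pow_expMeasure hr 1).const_mul b
  refine h.mono' (Measurable.log (by fun_prop)).aestronglyMeasurable ?_
  filter_upwards [ae_expMeasure_pos r] with x hx
  have hbx : 0 < b * x := by positivity
  rw [Real.norm_of_nonneg (Real.log_nonneg (by linarith))]
  have := Real.log_le_sub_one_of_pos (show 0 < 1 + b * x by linarith)
  simp; linarith

/-- The substitution `t = -r * (x + 1 / b)` carries the half-line `x > 0` to `t < -(r / b)`; the
shift by `1 / b` produces the factor `exp (r / b)`. -/
lemma integral_exp_div_one_add (hr : 0 < r) {b : ℝ} (hb : 0 < b) :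
    ∫ x in Ioi (0 : ℝ), b / (1 + b * x) * Real.exp (-(r * x)) =
      -(Real.exp (r / b) * Ei (-(r / b))) := by
  have h1 : Ei (-(r / b)) = ∫ t in Ioi (r / b), Real.exp (-t) / (-t) := by
    have := integral_comp_neg_Iic (-(r / b)) (fun t => Real.exp (-t) / (-t))
    simpa [Ei] using this
  have h2 : Ei (-(r / b)) = r * ∫ x in Ioi (1 / b), Real.exp (-(r * x)) / (-(r * x)) := by
    rw [h1, integral_comp_mul_left_Ioi (fun t => Real.exp (-t) / (-t)) _ hr, smul_eq_mul,
      ← mul_assoc, mul_inv_cancel₀ hr.ne', one_mul, mul_one_div]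
  have h3 := (measurePreserving_add_right (volume : Measure ℝ) (1 / b)).setIntegral_preimage_emb
    (measurableEmbedding_addRight (1 / b)) (fun x => Real.exp (-(r * x)) / (-(r * x)))
    (Ioi (1 / b))
  rw [h2, ← h3, ← integral_const_mul, ← integral_const_mul, ← integral_neg]
  have hpre : (fun x : ℝ => x + 1 / b) ⁻¹' Ioi (1 / b) = Ioi 0 := by
    ext x; simp
  rw [hpre]
  refine setIntegral_congr_fun measurableSet_Ioi fun x hx => ?_
  have hx : 0 < x := hx
  have hexp : Real.exp (-(r * (x + 1 / b))) = Real.exp (-(r * x)) / Real.exp (r / b) := by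
    rw [← Real.exp_sub]; congr 1; ring
  have : 0 < 1 + b * x := by positivity
  have h4 : x + 1 / b = (1 + b * x) / b := by field_simp; ring
  rw [hexp, h4]
  field_simp

/-- Integration by parts against the antiderivative `-exp (-(r * x))`. The boundary terms vanish:
the logarithm is zero at `0`, and at infinity it is at most `b * x`, which the exponential kills. -/
lemma integral_log_one_add_expMeasure (hr : 0 < r) {b : ℝ} (hb : 0 < b) :
    ∫ x, Real.log (1 + b * x) ∂expMeasure r = -(Real.exp (r / b) * Ei (-(r / b))) := by
  rw [integral_expMeasure hr, ← integral_exp_div_one_add hr hb]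
  have hpos : ∀ x ∈ Ioi (0 : ℝ), 0 < 1 + b * x := fun x hx => by
    have : 0 < x := hx
    positivity
  have hexp : IntegrableOn (fun x => Real.exp (-(r * x))) (Ioi 0) := by
    simpa using integrableOn_exp_mul_Ioi (neg_lt_zero.2 hr) 0
  have hu : ∀ x ∈ Ioi (0 : ℝ), HasDerivAt (fun x => Real.log (1 + b * x)) (b / (1 + b * x)) x := by
    intro x hx
    have h := ((hasDerivAt_id x).const_mul b).const_add 1
    simpa using h.log (hpos x hx).ne'
  have hv : ∀ x ∈ Ioi (0 : ℝ),
      HasDerivAt (fun x => -Real.exp (-(r * x))) (r * Real.exp (-(r * x))) x :=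
    fun x _ => hasDerivAt_neg_exp_mul_exp
  have hint := (integrable_expMeasure_iff hr _).1 (integrable_log_one_add_expMeasure hr hb)
  have key := integral_Ioi_mul_deriv_eq_deriv_mul (a' := 0) (b' := 0) hu hv ?_ ?_ ?_ ?_
  · simp only [smul_eq_mul]
    calc _ = ∫ x in Ioi (0 : ℝ), Real.log (1 + b * x) * (r * Real.exp (-(r * x))) := by
          simp_rw [mul_comm (Real.log _)]
      _ = _ := by
          rw [key, sub_zero, zero_sub, ← integral_neg]
          simp
  · refine hint.congr (ae_of_all _ fun x => ?_)
    simp [mul_comm]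
  · have : IntegrableOn (fun x => b * Real.exp (-(r * x))) (Ioi 0) := hexp.const_mul b
    refine this.mono' (by simp only [Pi.mul_def]; fun_prop) ?_
    filter_upwards [ae_restrict_mem measurableSet_Ioi] with x hx
    have hx' : 0 < x := hx
    simp only [Pi.mul_apply, norm_mul, norm_neg, Real.norm_eq_abs, Real.abs_exp]
    gcongr
    rw [abs_of_pos (div_pos hb (hpos x hx))]
    exact div_le_self hb.le (by nlinarith)
  · have : ContinuousAt (fun x : ℝ => Real.log (1 + b * x) * -Real.exp (-(r * x))) 0 := by
      refine ContinuousAt.mul (ContinuousAt.log (by fun_prop) (by simp)) (by fun_prop)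
    have h := this.tendsto
    simp only [mul_zero, add_zero, Real.log_one, zero_mul] at h
    exact h.mono_left nhdsWithin_le_nhds
  · have h1 : Tendsto (fun x : ℝ => b * (x * Real.exp (-(r * x)))) atTop (𝓝 0) := by
      have := (tendsto_rpow_mul_exp_neg_mul_atTop_nhds_zero 1 r hr).const_mul b
      simpa using this
    refine squeeze_zero_norm' ?_ h1
    filter_upwards [eventually_gt_atTop 0] with x hx
    have h2 := hpos x hx
    have hbx : 0 < b * x := by positivity
    simp only [Pi.mul_apply, norm_mul, norm_neg, Real.norm_eq_abs, Real.abs_exp]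
    rw [abs_of_nonneg (Real.log_nonneg (by linarith)), ← mul_assoc]
    gcongr
    have := Real.log_le_sub_one_of_pos h2
    linarith

end Exponential

end VLC

namespace VLC

open Set Filter Topology

/-- Gibbs' inequality for log-likelihoods. -/
lemma integral_le_integral_of_lintegral_exp_sub_le_one {α : Type*} [MeasurableSpace α]
    {P : Measure α} [IsProbabilityMeasure P] {F G : α → ℝ} (hF : Integrable F P)
    (hG : Integrable G P) (h : ∫⁻ x, ENNReal.ofReal (Real.exp (G x - F x)) ∂P ≤ 1) :
    ∫ x, G x ∂P ≤ ∫ x, F x ∂P := by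
  have hm : AEStronglyMeasurable (fun x => Real.exp (G x - F x)) P :=
    Real.continuous_exp.comp_aestronglyMeasurable (hG.sub hF).aestronglyMeasurable
  have hnn : 0 ≤ᵐ[P] fun x => Real.exp (G x - F x) := ae_of_all _ fun x => (Real.exp_pos _).le
  have hint : Integrable (fun x => Real.exp (G x - F x)) P := by
    refine ⟨hm, ?_⟩
    rw [hasFiniteIntegral_iff_ofReal hnn]
    exact h.trans_lt ENNReal.one_lt_top
  have h1 : ∫ x, Real.exp (G x - F x) ∂P ≤ 1 := by
    rw [integral_eq_lintegral_of_nonneg_ae hnn hm]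
    simpa using ENNReal.toReal_mono ENNReal.one_ne_top h
  -- The whole inequality is `u ≤ exp u - 1` integrated; the hypothesis makes the right side
  -- nonpositive.
  have h2 : ∫ x, (G x - F x) ∂P ≤ ∫ x, (Real.exp (G x - F x) - 1) ∂P :=
    integral_mono (hG.sub hF) (hint.sub (integrable_const 1)) fun x => by
      have := Real.add_one_le_exp (G x - F x)
      simp only; linarith
  rw [integral_sub hG hF, integral_sub hint (integrable_const 1)] at h2
  simp at h2
  linarith

/-! ### The asymmetric Laplace law of the signal-dependent part of the output -/

section Laplace

variable {a s : ℝ}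

/-- The density of `U + √U Z` with `U` exponential of mean `a` and `Z ∼ N(0, s)`. -/
noncomputable def laplacePDF (a s y : ℝ) : ℝ :=
  Real.exp (y / s - |y| * √(1 + 2 * s / a) / s) / (a * √(1 + 2 * s / a))

lemma laplacePDF_pos (ha : 0 < a) (hs : 0 < s) (y : ℝ) : 0 < laplacePDF a s y := by
  unfold laplacePDF; positivity

lemma measurable_laplacePDF (a s : ℝ) : Measurable (laplacePDF a s) := by
  unfold laplacePDF; fun_prop

lemma log_laplacePDF (ha : 0 < a) (hs : 0 < s) (y : ℝ) :
    Real.log (laplacePDF a s y) =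
      y / s - |y| * √(1 + 2 * s / a) / s - Real.log (a * √(1 + 2 * s / a)) := by
  rw [laplacePDF, Real.log_div (Real.exp_pos _).ne' (by positivity), Real.log_exp]

lemma one_lt_sqrt_one_add (ha : 0 < a) (hs : 0 < s) : 1 < √(1 + 2 * s / a) := by
  rw [Real.lt_sqrt (by norm_num)]
  have : 0 < 2 * s / a := by positivity
  linarith

/-- On each side of the origin the density is a pure exponential, so the Fourier integral splits
into two elementary half-line integrals. -/
lemma laplacePDF_mul_cexp_of_nonpos (t : ℝ) {y : ℝ} (hy : y ≤ 0) :
    (laplacePDF a s y) * Complex.exp (t * y * Complex.I) =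
      (a * √(1 + 2 * s / a) : ℝ)⁻¹ *
        Complex.exp ((((1 + √(1 + 2 * s / a)) / s : ℝ) + t * Complex.I) * y) := by
  rw [laplacePDF, abs_of_nonpos hy]
  push_cast
  rw [div_eq_inv_mul, mul_assoc, ← Complex.exp_add]
  congr 2
  ring

lemma laplacePDF_mul_cexp_of_nonneg (t : ℝ) {y : ℝ} (hy : 0 ≤ y) :
    (laplacePDF a s y) * Complex.exp (t * y * Complex.I) =
      (a * √(1 + 2 * s / a) : ℝ)⁻¹ *
        Complex.exp ((((1 - √(1 + 2 * s / a)) / s : ℝ) + t * Complex.I) * y) := by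
  rw [laplacePDF, abs_of_nonneg hy]
  push_cast
  rw [div_eq_inv_mul, mul_assoc, ← Complex.exp_add]
  congr 2
  ring

lemma integrableOn_Iic_laplacePDF_mul_cexp (hs : 0 < s) (t : ℝ) :
    IntegrableOn (fun y : ℝ => (laplacePDF a s y) * Complex.exp (t * y * Complex.I)) (Iic 0) := by
  have hre : 0 < ((((1 + √(1 + 2 * s / a)) / s : ℝ) : ℂ) + t * Complex.I).re := by
    simp; positivity
  exact IntegrableOn.congr_fun ((integrableOn_exp_mul_complex_Iic hre 0).const_mul _)
    (fun y hy => (laplacePDF_mul_cexp_of_nonpos t hy).symm) measurableSet_Iic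

lemma integrableOn_Ioi_laplacePDF_mul_cexp (ha : 0 < a) (hs : 0 < s) (t : ℝ) :
    IntegrableOn (fun y : ℝ => (laplacePDF a s y) * Complex.exp (t * y * Complex.I)) (Ioi 0) := by
  have hre : ((((1 - √(1 + 2 * s / a)) / s : ℝ) : ℂ) + t * Complex.I).re < 0 := by
    have := one_lt_sqrt_one_add ha hs
    simpa using div_neg_of_neg_of_pos (by linarith) hs
  exact IntegrableOn.congr_fun ((integrableOn_exp_mul_complex_Ioi hre 0).const_mul _)
    (fun y hy => (laplacePDF_mul_cexp_of_nonneg t (le_of_lt hy)).symm) measurableSet_Ioi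

lemma integrable_laplacePDF (ha : 0 < a) (hs : 0 < s) : Integrable (laplacePDF a s) := by
  have h := (integrableOn_Iic_laplacePDF_mul_cexp (a := a) hs 0).union
    (integrableOn_Ioi_laplacePDF_mul_cexp ha hs 0)
  rw [Iic_union_Ioi, integrableOn_univ] at h
  simpa using h.re

/-- The real part is `1 + a * s * t ^ 2 / 2`, which is positive. -/
lemma one_sub_mul_ne_zero (ha : 0 < a) (hs : 0 < s) (t : ℝ) :
    (1 : ℂ) - a * (t * Complex.I - s * t ^ 2 / 2) ≠ 0 := by
  intro h
  have := congrArg Complex.re h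
  simp [← Complex.ofReal_pow] at this
  have h2 : 0 ≤ a * (s * t ^ 2 / 2) := by positivity
  linarith

lemma integral_laplacePDF_mul_cexp (ha : 0 < a) (hs : 0 < s) (t : ℝ) :
    ∫ y : ℝ, (laplacePDF a s y) * Complex.exp (t * y * Complex.I) =
      1 / (1 - a * (t * Complex.I - s * t ^ 2 / 2)) := by
  have hr := one_lt_sqrt_one_add ha hs
  have hK := one_sub_mul_ne_zero ha hs t
  have hsq : √(1 + 2 * s / a) ^ 2 = 1 + 2 * s / a := Real.sq_sqrt (by positivity)
  have hre1 : 0 < ((((1 + √(1 + 2 * s / a)) / s : ℝ) : ℂ) + t * Complex.I).re := by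
    simp; positivity
  have hre2 : ((((1 - √(1 + 2 * s / a)) / s : ℝ) : ℂ) + t * Complex.I).re < 0 := by
    simpa using div_neg_of_neg_of_pos (by linarith) hs
  rw [← setIntegral_univ, ← Iic_union_Ioi (a := (0 : ℝ)),
    setIntegral_union (Set.Iic_disjoint_Ioi le_rfl) measurableSet_Ioi
      (integrableOn_Iic_laplacePDF_mul_cexp hs t) (integrableOn_Ioi_laplacePDF_mul_cexp ha hs t),
    setIntegral_congr_fun measurableSet_Iic
      (fun y hy => laplacePDF_mul_cexp_of_nonpos (a := a) (s := s) t hy),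
    setIntegral_congr_fun measurableSet_Ioi
      (fun y hy => laplacePDF_mul_cexp_of_nonneg (a := a) (s := s) t (le_of_lt hy)),
    integral_const_mul, integral_const_mul, integral_exp_mul_complex_Iic hre1,
    integral_exp_mul_complex_Ioi hre2]
  generalize √(1 + 2 * s / a) = r at *
  have h1 : (((1 + r) / s : ℝ) : ℂ) + t * Complex.I ≠ 0 := fun h => by rw [h] at hre1; simp at hre1
  have h2 : (((1 - r) / s : ℝ) : ℂ) + t * Complex.I ≠ 0 := fun h => by rw [h] at hre2; simp at hre2
  have hsc : (s : ℂ) ≠ 0 := by exact_mod_cast hs.ne'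
  have hac : (a : ℂ) ≠ 0 := by exact_mod_cast ha.ne'
  have hrc : (r : ℂ) ≠ 0 := by exact_mod_cast (by linarith : r ≠ 0)
  have hsqc : (r : ℂ) ^ 2 * a = a + 2 * s := by
    have : r ^ 2 * a = a + 2 * s := by rw [hsq]; field_simp
    exact_mod_cast this
  push_cast at *
  -- The choice `r ^ 2 = 1 + 2 * s / a` is made for this factorization: the two exponential rates,
  -- shifted by `i t`, multiply to the denominator of the target up to a constant.
  have hprod : ((1 + r : ℂ) / s + t * Complex.I) * ((1 - r : ℂ) / s + t * Complex.I) =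
      -(2 / (a * s)) * (1 - a * (t * Complex.I - s * t ^ 2 / 2)) := by
    field_simp
    linear_combination (-1 : ℂ) * hsqc + (a * s ^ 2 * t ^ 2 : ℂ) * Complex.I_sq
  have hsum : (1 : ℂ) / ((1 + r : ℂ) / s + t * Complex.I) +
      -1 / ((1 - r : ℂ) / s + t * Complex.I) =
      -(2 * r / s) / (((1 + r : ℂ) / s + t * Complex.I) * ((1 - r : ℂ) / s + t * Complex.I)) := by
    rw [div_add_div _ _ h1 h2]
    congr 1
    ring
  simp only [mul_zero, Complex.exp_zero]
  rw [← mul_add, hsum, hprod]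
  field_simp

/-- Characteristic functions agree. Given `X = x`, the variable is Gaussian with mean `H * x` and
variance `H * x * s`, so its characteristic function is an exponential linear in `x`, and averaging
over the exponential law gives a rational function. -/
lemma map_expMeasure_prod_gaussianReal {H m : ℝ} (hH : 0 < H) (hm : 0 < m) (hs : 0 < s) :
    ((expMeasure m⁻¹).prod (gaussianReal 0 s.toNNReal)).map
        (fun q : ℝ × ℝ => H * q.1 + √(H * q.1) * q.2) =
      volume.withDensity fun y => ENNReal.ofReal (laplacePDF (H * m) s y) := by
  have hm' : 0 < m⁻¹ := inv_pos.2 hm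
  have ha : 0 < H * m := by positivity
  have := isProbabilityMeasure_expMeasure hm'
  have hmeas : Measurable (fun q : ℝ × ℝ => H * q.1 + √(H * q.1) * q.2) := by fun_prop
  have := Measure.isProbabilityMeasure_map (μ := (expMeasure m⁻¹).prod (gaussianReal 0 s.toNNReal))
    hmeas.aemeasurable
  have : IsFiniteMeasure
      (volume.withDensity fun y => ENNReal.ofReal (laplacePDF (H * m) s y)) :=
    isFiniteMeasure_withDensity_ofReal (integrable_laplacePDF ha hs).2
  refine Measure.ext_of_charFun (funext fun t => ?_)
  rw [charFun_apply_real, charFun_apply_real,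
    integral_withDensity_eq_integral_toReal_smul₀
      (measurable_laplacePDF _ _).ennreal_ofReal.aemeasurable (by simp),
    integral_map hmeas.aemeasurable (by fun_prop)]
  have hR : ∫ y : ℝ, (ENNReal.ofReal (laplacePDF (H * m) s y)).toReal •
      Complex.exp (t * y * Complex.I) =
      1 / (1 - (H * m : ℝ) * (t * Complex.I - s * t ^ 2 / 2)) := by
    rw [← integral_laplacePDF_mul_cexp ha hs t]
    congr with y
    rw [ENNReal.toReal_ofReal (laplacePDF_pos ha hs y).le, Complex.real_smul]
  rw [hR, integral_prod]
  · have hinner : ∀ᵐ x ∂expMeasure m⁻¹,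
        ∫ n, Complex.exp (t * (H * x + √(H * x) * n : ℝ) * Complex.I) ∂gaussianReal 0 s.toNNReal =
          Complex.exp ((H * (t * Complex.I - s * t ^ 2 / 2)) * x) := by
      filter_upwards [ae_expMeasure_pos m⁻¹] with x hx
      have hc := charFun_gaussianReal (μ := 0) (v := s.toNNReal) (t * √(H * x))
      rw [charFun_apply_real] at hc
      have : ∀ n : ℝ, Complex.exp (t * (H * x + √(H * x) * n : ℝ) * Complex.I) =
          Complex.exp (t * H * x * Complex.I) *
            Complex.exp ((t * √(H * x) : ℝ) * n * Complex.I) := by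
        intro n
        rw [← Complex.exp_add]
        congr 1
        push_cast; ring
      simp_rw [this]
      rw [integral_const_mul, hc, ← Complex.exp_add]
      congr 1
      have hsq : (√(H * x) : ℂ) ^ 2 = H * x := by
        exact_mod_cast Real.sq_sqrt (show 0 ≤ H * x by positivity)
      have hsv : ((s.toNNReal : ℝ) : ℂ) = s := by rw [Real.coe_toNNReal _ hs.le]
      push_cast
      rw [hsv, mul_pow, hsq]
      ring
    rw [integral_congr_ae hinner, integral_cexp_expMeasure hm']
    · have hK := one_sub_mul_ne_zero ha hs t
      have hmc : (m : ℂ) ≠ 0 := by exact_mod_cast hm.ne'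
      push_cast at *
      have h2 : (m : ℂ)⁻¹ - H * (t * Complex.I - s * t ^ 2 / 2) ≠ 0 := by
        intro h
        apply hK
        linear_combination (m : ℂ) * h - mul_inv_cancel₀ hmc
      rw [div_eq_div_iff h2 hK]
      field_simp
    · have : 0 ≤ H * (s * t ^ 2 / 2) := by positivity
      simpa [← Complex.ofReal_pow] using this
  · refine Integrable.of_bound (C := 1) (by fun_prop) (ae_of_all _ fun q => ?_)
    rw [← Complex.ofReal_mul, Complex.norm_exp_ofReal_mul_I]

end Laplace

end VLC

/-! ### Relative entropy through a density, and Gaussian preliminaries -/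

namespace VLC

open Set Filter Topology

/-- Both measures have mass one, so the mass correction in `klDiv` vanishes; integrability of the
log-density makes the value finite, which later allows subtraction as reals. -/
lemma coe_klDiv_withDensity {α : Type*} [MeasurableSpace α] {ν ρ : Measure α}
    [IsProbabilityMeasure ν] [IsProbabilityMeasure ρ] {g : α → ℝ} (hg : Measurable g)
    (hpos : ∀ x, 0 < g x) (hρ : ρ = ν.withDensity fun x => ENNReal.ofReal (g x))
    (hint : Integrable (fun x => Real.log (g x)) ρ) :
    (klDiv ρ ν : EReal) = ((∫ x, Real.log (g x) ∂ρ : ℝ) : EReal) := by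
  have hac : ρ ≪ ν := hρ ▸ withDensity_absolutelyContinuous _ _
  have hllr : llr ρ ν =ᵐ[ρ] fun x => Real.log (g x) := by
    have h := Measure.rnDeriv_withDensity ν hg.ennreal_ofReal
    rw [← hρ] at h
    filter_upwards [hac.ae_le h] with x hx
    rw [llr, hx, ENNReal.toReal_ofReal (hpos x).le]
  have hint' : Integrable (llr ρ ν) ρ := hint.congr hllr.symm
  have hnn := integral_llr_add_sub_measure_univ_nonneg hac hint'
  rw [klDiv_of_ac_of_integrable hac hint', EReal.coe_ennreal_ofReal, max_eq_left hnn,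
    integral_congr_ae hllr]
  simp

lemma integral_id_sq_gaussianReal_zero_one : ∫ t, t ^ 2 ∂gaussianReal 0 1 = 1 := by
  have h := variance_eq_sub (memLp_id_gaussianReal (μ := 0) (v := 1) 2)
  rw [variance_id_gaussianReal] at h
  simp [integral_id_gaussianReal] at h
  exact h.symm

lemma integrable_id_gaussianReal (m : ℝ) (v : NNReal) :
    Integrable (fun t : ℝ => t) (gaussianReal m v) :=
  (memLp_id_gaussianReal (μ := m) (v := v) 1).integrable le_rfl

lemma integrable_id_sq_gaussianReal (m : ℝ) (v : NNReal) :
    Integrable (fun t : ℝ => t ^ 2) (gaussianReal m v) :=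
  (memLp_id_gaussianReal (μ := m) (v := v) 2).integrable_sq

lemma log_gaussianPDFReal (m : ℝ) {v : NNReal} (hv : v ≠ 0) (y : ℝ) :
    Real.log (gaussianPDFReal m v y) =
      -(1 / 2) * Real.log (2 * Real.pi * v) - (y - m) ^ 2 / (2 * v) := by
  have hv' : (0 : ℝ) < v := by exact_mod_cast pos_iff_ne_zero.2 hv
  rw [gaussianPDFReal_def]
  simp only
  rw [Real.log_mul (by positivity) (Real.exp_pos _).ne', Real.log_exp, Real.log_inv,
    Real.log_sqrt (by positivity)]
  ring

/-! ### The channel as a Gaussian kernel: joint and output densities -/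

section Channel

/-- The variance of the output of the channel given the input `x`. -/
noncomputable def noiseVar (H σ ς x : ℝ) : NNReal := (σ ^ 2 * (1 + H * ς ^ 2 * |x|)).toNNReal

/-- The density of the output of the channel given the input `x`. -/
noncomputable def channelPDF (H σ ς x y : ℝ) : ℝ := gaussianPDFReal (H * x) (noiseVar H σ ς x) y

/-- The density of the output of the channel for an input of law `μ`. -/
noncomputable def outputPDF (H σ ς : ℝ) (μ : Measure ℝ) (y : ℝ) : ℝ := ∫ x, channelPDF H σ ς x y ∂μ

variable {H σ ς : ℝ} {μ : Measure ℝ}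

lemma coe_noiseVar (hH : 0 < H) (x : ℝ) :
    (noiseVar H σ ς x : ℝ) = σ ^ 2 * (1 + H * ς ^ 2 * |x|) :=
  Real.coe_toNNReal _ (by positivity)

/-- This is what `|x|` in `noiseVar` buys: the bound holds for every real `x`, so the densities
below are positive and bounded everywhere, while admissible inputs see the true variance. -/
lemma sq_le_noiseVar (hH : 0 < H) (x : ℝ) : σ ^ 2 ≤ noiseVar H σ ς x := by
  rw [coe_noiseVar hH]
  have : 0 ≤ σ ^ 2 * (H * ς ^ 2 * |x|) := by positivity
  linarith

lemma noiseVar_pos (hH : 0 < H) (hσ : 0 < σ) (x : ℝ) : (0 : ℝ) < noiseVar H σ ς x :=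
  (by positivity : 0 < σ ^ 2).trans_le (sq_le_noiseVar hH x)

lemma noiseVar_ne_zero (hH : 0 < H) (hσ : 0 < σ) (x : ℝ) : noiseVar H σ ς x ≠ 0 := by
  have := noiseVar_pos (ς := ς) hH hσ x
  exact_mod_cast this.ne'

@[fun_prop]
lemma measurable_noiseVar : Measurable (noiseVar H σ ς) := by
  unfold noiseVar; fun_prop

lemma measurable_uncurry_channelPDF :
    Measurable (fun q : ℝ × ℝ => channelPDF H σ ς q.1 q.2) :=
  measurable_uncurry_gaussianPDFReal.comp
    (by fun_prop : Measurable fun q : ℝ × ℝ => (H * q.1, noiseVar H σ ς q.1, q.2))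

lemma channelPDF_pos (hH : 0 < H) (hσ : 0 < σ) (x y : ℝ) : 0 < channelPDF H σ ς x y :=
  gaussianPDFReal_pos _ _ _ (noiseVar_ne_zero hH hσ x)

lemma channelPDF_le (hH : 0 < H) (hσ : 0 < σ) (x y : ℝ) :
    channelPDF H σ ς x y ≤ (√(2 * Real.pi * σ ^ 2))⁻¹ := by
  rw [channelPDF, gaussianPDFReal_def]
  have h1 : (√(2 * Real.pi * noiseVar H σ ς x))⁻¹ ≤ (√(2 * Real.pi * σ ^ 2))⁻¹ := by
    gcongr
    exact sq_le_noiseVar hH x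
  refine le_trans (mul_le_of_le_one_right (by positivity) ?_) h1
  rw [Real.exp_le_one_iff, neg_div]
  have := noiseVar_pos (ς := ς) hH hσ x
  simp only [Left.neg_nonpos_iff]
  positivity

lemma integrable_channelPDF [IsProbabilityMeasure μ] (hH : 0 < H) (hσ : 0 < σ) (y : ℝ) :
    Integrable (fun x => channelPDF H σ ς x y) μ := by
  refine Integrable.of_bound (C := (√(2 * Real.pi * σ ^ 2))⁻¹)
    (measurable_uncurry_channelPDF.comp measurable_prodMk_right).aestronglyMeasurable
    (ae_of_all _ fun x => ?_)
  rw [Real.norm_of_nonneg (channelPDF_pos hH hσ x y).le]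
  exact channelPDF_le hH hσ x y

lemma outputPDF_pos [IsProbabilityMeasure μ] (hH : 0 < H) (hσ : 0 < σ) (y : ℝ) :
    0 < outputPDF H σ ς μ y := by
  rw [outputPDF, integral_pos_iff_support_of_nonneg (fun x => (channelPDF_pos hH hσ x y).le)
    (integrable_channelPDF hH hσ y)]
  have : Function.support (fun x => channelPDF H σ ς x y) = univ := by
    ext x; simp [(channelPDF_pos hH hσ x y).ne']
  simp [this]

lemma outputPDF_le [IsProbabilityMeasure μ] (hH : 0 < H) (hσ : 0 < σ) (y : ℝ) :
    outputPDF H σ ς μ y ≤ (√(2 * Real.pi * σ ^ 2))⁻¹ := by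
  have := integral_mono (integrable_channelPDF (μ := μ) (ς := ς) hH hσ y) (integrable_const _)
    fun x => channelPDF_le hH hσ x y
  simpa [outputPDF] using this

lemma measurable_outputPDF [SFinite μ] : Measurable (outputPDF H σ ς μ) :=
  (StronglyMeasurable.integral_prod_left (μ := μ)
    (f := fun x y => channelPDF H σ ς x y)
    measurable_uncurry_channelPDF.stronglyMeasurable).measurable

lemma ofReal_outputPDF [IsProbabilityMeasure μ] (hH : 0 < H) (hσ : 0 < σ) (y : ℝ) :
    ENNReal.ofReal (outputPDF H σ ς μ y) = ∫⁻ x, ENNReal.ofReal (channelPDF H σ ς x y) ∂μ :=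
  ofReal_integral_eq_lintegral_ofReal (integrable_channelPDF hH hσ y)
    (ae_of_all _ fun x => (channelPDF_pos hH hσ x y).le)

/-- Independent Gaussians add: the scaled noise contributes `H * x * ς ^ 2 * σ ^ 2` and the additive
one `σ ^ 2`. -/
lemma map_noiseLaw (hH : 0 < H) {x : ℝ} (hx : 0 ≤ x) :
    (noiseLaw σ ς).map (fun n => H * x + √(H * x) * n.1 + n.2) =
      gaussianReal (H * x) (noiseVar H σ ς x) := by
  have h1 : (fun n : ℝ × ℝ => H * x + √(H * x) * n.1 + n.2) =
      (fun q : ℝ × ℝ => q.1 + q.2) ∘ Prod.map ((fun u => H * x + u) ∘ fun u => √(H * x) * u) id := by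
    ext n; simp
  rw [h1, ← Measure.map_map (by fun_prop) (by fun_prop), noiseLaw,
    ← Measure.map_prod_map _ _ (by fun_prop) measurable_id, Measure.map_id,
    ← Measure.map_map (by fun_prop) (by fun_prop), gaussianReal_map_const_mul,
    gaussianReal_map_const_add]
  change Measure.conv _ _ = _
  rw [gaussianReal_conv_gaussianReal]
  congr 1
  · simp
  · apply NNReal.eq
    push_cast
    rw [coe_noiseVar hH, Real.coe_toNNReal _ (by positivity), Real.coe_toNNReal _ (by positivity),
      abs_of_nonneg hx, Real.sq_sqrt (by positivity)]
    ring

lemma map_gaussianReal_zero_one (m : ℝ) (v : NNReal) :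
    (gaussianReal 0 1).map (fun t => m + √v * t) = gaussianReal m v := by
  have h1 : (fun t : ℝ => m + √v * t) = (fun u => m + u) ∘ fun u => √v * u := rfl
  rw [h1, ← Measure.map_map (by fun_prop) (by fun_prop), gaussianReal_map_const_mul,
    gaussianReal_map_const_add]
  congr 1
  · simp
  · apply NNReal.eq
    push_cast
    rw [Real.sq_sqrt v.coe_nonneg, mul_one]

lemma measurable_noiseLaw_map :
    Measurable (fun w : ℝ × (ℝ × ℝ) => (w.1, H * w.1 + √(H * w.1) * w.2.1 + w.2.2)) := by
  fun_prop

instance : IsProbabilityMeasure (noiseLaw σ ς) := by unfold noiseLaw; infer_instance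

instance [IsProbabilityMeasure μ] : IsProbabilityMeasure (inputOutputLaw H σ ς μ) :=
  Measure.isProbabilityMeasure_map measurable_noiseLaw_map.aemeasurable

lemma inputOutputLaw_apply [IsProbabilityMeasure μ] (hH : 0 < H) (h0 : ∀ᵐ x ∂μ, 0 ≤ x)
    {s : Set (ℝ × ℝ)} (hs : MeasurableSet s) :
    inputOutputLaw H σ ς μ s =
      ∫⁻ x, gaussianReal (H * x) (noiseVar H σ ς x) (Prod.mk x ⁻¹' s) ∂μ := by
  rw [inputOutputLaw, Measure.map_apply measurable_noiseLaw_map hs,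
    Measure.prod_apply (measurable_noiseLaw_map hs)]
  refine lintegral_congr_ae ?_
  filter_upwards [h0] with x hx
  rw [← map_noiseLaw hH hx, Measure.map_apply (by fun_prop) (measurable_prodMk_left hs)]
  rfl

/-- Only the conditional law matters, so the two noises merge into one standard Gaussian independent
of `X`. Moments and log-densities then become integrals over a product measure. -/
lemma inputOutputLaw_eq_map [IsProbabilityMeasure μ] (hH : 0 < H) (h0 : ∀ᵐ x ∂μ, 0 ≤ x) :
    inputOutputLaw H σ ς μ =
      (μ.prod (gaussianReal 0 1)).map
        (fun q => (q.1, H * q.1 + √(noiseVar H σ ς q.1) * q.2)) := by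
  have hm : Measurable
      (fun q : ℝ × ℝ => (q.1, H * q.1 + √(noiseVar H σ ς q.1) * q.2)) := by fun_prop
  ext s hs
  rw [inputOutputLaw_apply hH h0 hs, Measure.map_apply hm hs, Measure.prod_apply (hm hs)]
  refine lintegral_congr fun x => ?_
  rw [← map_gaussianReal_zero_one, Measure.map_apply (by fun_prop) (measurable_prodMk_left hs)]
  rfl

lemma inputOutputLaw_eq_withDensity [IsProbabilityMeasure μ] (hH : 0 < H) (hσ : 0 < σ)
    (h0 : ∀ᵐ x ∂μ, 0 ≤ x) :
    inputOutputLaw H σ ς μ =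
      (μ.prod volume).withDensity (fun q => ENNReal.ofReal (channelPDF H σ ς q.1 q.2)) := by
  ext s hs
  have hm : Measurable (fun q : ℝ × ℝ => ENNReal.ofReal (channelPDF H σ ς q.1 q.2)) :=
    measurable_uncurry_channelPDF.ennreal_ofReal
  rw [inputOutputLaw_apply hH h0 hs, withDensity_apply _ hs, ← lintegral_indicator hs,
    lintegral_prod _ (hm.indicator hs).aemeasurable]
  refine lintegral_congr fun x => ?_
  rw [gaussianReal_apply _ (noiseVar_ne_zero hH hσ x),
    ← lintegral_indicator (measurable_prodMk_left hs)]
  rfl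

lemma fst_inputOutputLaw [IsProbabilityMeasure μ] : (inputOutputLaw H σ ς μ).fst = μ := by
  rw [inputOutputLaw, Measure.fst_map_prodMk (by fun_prop)]
  exact Measure.fst_prod

lemma snd_inputOutputLaw [IsProbabilityMeasure μ] (hH : 0 < H) (hσ : 0 < σ)
    (h0 : ∀ᵐ x ∂μ, 0 ≤ x) :
    (inputOutputLaw H σ ς μ).snd =
      volume.withDensity (fun y => ENNReal.ofReal (outputPDF H σ ς μ y)) := by
  ext s hs
  have hm : Measurable (fun q : ℝ × ℝ => ENNReal.ofReal (channelPDF H σ ς q.1 q.2)) :=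
    measurable_uncurry_channelPDF.ennreal_ofReal
  rw [Measure.snd_apply hs, inputOutputLaw_eq_withDensity hH hσ h0,
    withDensity_apply _ (measurable_snd hs), withDensity_apply _ hs,
    ← univ_prod, ← Measure.prod_restrict, Measure.restrict_univ,
    lintegral_prod_symm _ hm.aemeasurable]
  exact lintegral_congr fun y => (ofReal_outputPDF hH hσ y).symm

/-- The logarithm of this ratio of conditional to output density is the integrand of the mutual
information. -/
lemma inputOutputLaw_eq_withDensity_prod [IsProbabilityMeasure μ] (hH : 0 < H) (hσ : 0 < σ)
    (h0 : ∀ᵐ x ∂μ, 0 ≤ x) :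
    inputOutputLaw H σ ς μ = (μ.prod (inputOutputLaw H σ ς μ).snd).withDensity
      (fun q => ENNReal.ofReal (channelPDF H σ ς q.1 q.2 / outputPDF H σ ς μ q.2)) := by
  have hp := measurable_outputPDF (H := H) (σ := σ) (ς := ς) (μ := μ)
  have hm : Measurable fun q : ℝ × ℝ => channelPDF H σ ς q.1 q.2 / outputPDF H σ ς μ q.2 :=
    measurable_uncurry_channelPDF.div (by fun_prop)
  rw [snd_inputOutputLaw hH hσ h0, prod_withDensity_right hp.ennreal_ofReal,
    ← withDensity_mul _ (by fun_prop) hm.ennreal_ofReal,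
    inputOutputLaw_eq_withDensity hH hσ h0]
  congr with q
  have := outputPDF_pos (μ := μ) (ς := ς) hH hσ q.2
  rw [Pi.mul_apply, ← ENNReal.ofReal_mul this.le, mul_div_cancel₀ _ this.ne']

/-! ### Moments of the output -/

section Moments

variable [IsProbabilityMeasure μ]

lemma integrable_noiseVar (hH : 0 < H) (h1 : Integrable (fun x => x) μ) :
    Integrable (fun x => (noiseVar H σ ς x : ℝ)) μ := by
  simp_rw [coe_noiseVar hH]
  exact ((integrable_const 1).add (h1.abs.const_mul _)).const_mul _

lemma integral_noiseVar (hH : 0 < H) (h0 : ∀ᵐ x ∂μ, 0 ≤ x) (h1 : Integrable (fun x => x) μ) :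
    ∫ x, (noiseVar H σ ς x : ℝ) ∂μ = σ ^ 2 * (1 + H * ς ^ 2 * ∫ x, x ∂μ) := by
  simp_rw [coe_noiseVar hH]
  rw [integral_const_mul, integral_add (integrable_const _) (h1.abs.const_mul _),
    integral_const_mul, integral_congr_ae (h0.mono fun x hx => abs_of_nonneg hx)]
  simp

lemma integrable_log_noiseVar (hH : 0 < H) (hσ : 0 < σ) (h1 : Integrable (fun x => x) μ) :
    Integrable (fun x => Real.log (noiseVar H σ ς x)) μ := by
  have hm : Measurable fun x => Real.log (noiseVar H σ ς x) := by
    apply Measurable.log; fun_prop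
  refine ((integrable_noiseVar (σ := σ) (ς := ς) hH h1).add
    (integrable_const |Real.log (σ ^ 2)|)).mono' hm.aestronglyMeasurable (ae_of_all _ fun x => ?_)
  have hv := noiseVar_pos (ς := ς) hH hσ x
  have h2 := Real.log_le_sub_one_of_pos hv
  have h3 := Real.log_le_log (by positivity) (sq_le_noiseVar (σ := σ) (ς := ς) hH x)
  have h4 := neg_abs_le (Real.log (σ ^ 2))
  rw [Real.norm_eq_abs, abs_le, Pi.add_apply]
  constructor <;> linarith [abs_nonneg (Real.log (σ ^ 2))]

lemma integral_snd_inputOutputLaw (hH : 0 < H) (h0 : ∀ᵐ x ∂μ, 0 ≤ x) {g : ℝ → ℝ}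
    (hg : Measurable g) :
    ∫ y, g y ∂(inputOutputLaw H σ ς μ).snd =
      ∫ q, g (H * q.1 + √(noiseVar H σ ς q.1) * q.2) ∂μ.prod (gaussianReal 0 1) := by
  rw [inputOutputLaw_eq_map hH h0, Measure.snd_map_prodMk (by fun_prop),
    integral_map (by fun_prop) hg.aestronglyMeasurable]

lemma integrable_snd_inputOutputLaw_iff (hH : 0 < H) (h0 : ∀ᵐ x ∂μ, 0 ≤ x) {g : ℝ → ℝ}
    (hg : Measurable g) :
    Integrable g (inputOutputLaw H σ ς μ).snd ↔
      Integrable (fun q => g (H * q.1 + √(noiseVar H σ ς q.1) * q.2))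
        (μ.prod (gaussianReal 0 1)) := by
  rw [inputOutputLaw_eq_map hH h0, Measure.snd_map_prodMk (by fun_prop),
    integrable_map_measure hg.aestronglyMeasurable (by fun_prop)]
  rfl

lemma integrable_sqrt_noiseVar_mul (hH : 0 < H) (h1 : Integrable (fun x => x) μ)
    (h2 : Integrable (fun x => x ^ 2) μ) :
    Integrable (fun x => x * √(noiseVar H σ ς x)) μ := by
  refine (h2.add (integrable_noiseVar (σ := σ) (ς := ς) hH h1)).mono'
    (by fun_prop) (ae_of_all _ fun x => ?_)
  rw [Real.norm_eq_abs, abs_mul, abs_of_nonneg (Real.sqrt_nonneg _), Pi.add_apply]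
  have h3 := Real.sq_sqrt (noiseVar H σ ς x).coe_nonneg
  nlinarith [sq_nonneg (|x| - √(noiseVar H σ ς x)), sq_abs x, sq_nonneg x,
    sq_nonneg (√(noiseVar H σ ς x))]

lemma integrable_sqrt_noiseVar (hH : 0 < H) (h1 : Integrable (fun x => x) μ) :
    Integrable (fun x => √(noiseVar H σ ς x)) μ := by
  refine ((integrable_const 1).add (integrable_noiseVar (σ := σ) (ς := ς) hH h1)).mono'
    (by fun_prop) (ae_of_all _ fun x => ?_)
  rw [Real.norm_eq_abs, abs_of_nonneg (Real.sqrt_nonneg _), Pi.add_apply]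
  have h3 := Real.sq_sqrt (noiseVar H σ ς x).coe_nonneg
  nlinarith [sq_nonneg (1 - √(noiseVar H σ ς x))]

lemma integrable_id_snd_inputOutputLaw (hH : 0 < H) (h0 : ∀ᵐ x ∂μ, 0 ≤ x)
    (h1 : Integrable (fun x => x) μ) :
    Integrable (fun y => y) (inputOutputLaw H σ ς μ).snd := by
  rw [integrable_snd_inputOutputLaw_iff hH h0 measurable_id']
  exact ((h1.const_mul H).comp_fst _).add
    ((integrable_sqrt_noiseVar hH h1).mul_prod (integrable_id_gaussianReal 0 1))

lemma integral_id_snd_inputOutputLaw (hH : 0 < H) (h0 : ∀ᵐ x ∂μ, 0 ≤ x)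
    (h1 : Integrable (fun x => x) μ) :
    ∫ y, y ∂(inputOutputLaw H σ ς μ).snd = H * ∫ x, x ∂μ := by
  rw [integral_snd_inputOutputLaw hH h0 measurable_id',
    integral_add ((h1.const_mul H).comp_fst _)
      ((integrable_sqrt_noiseVar hH h1).mul_prod (integrable_id_gaussianReal 0 1)),
    integral_fun_fst (fun x => H * x), integral_prod_mul (fun x => √(noiseVar H σ ς x)) (fun t => t),
    integral_id_gaussianReal, integral_const_mul]
  simp

lemma sq_add_sqrt_mul (a b : ℝ) (v : NNReal) :
    (a + √v * b) ^ 2 = a ^ 2 + 2 * (a * √v) * b + v * b ^ 2 := by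
  linear_combination b ^ 2 * Real.sq_sqrt v.coe_nonneg

lemma integrable_sq_snd_inputOutputLaw (hH : 0 < H) (h0 : ∀ᵐ x ∂μ, 0 ≤ x)
    (h1 : Integrable (fun x => x) μ) (h2 : Integrable (fun x => x ^ 2) μ) :
    Integrable (fun y => y ^ 2) (inputOutputLaw H σ ς μ).snd := by
  rw [integrable_snd_inputOutputLaw_iff hH h0 (by fun_prop)]
  simp_rw [sq_add_sqrt_mul, mul_pow, mul_assoc H, ← mul_assoc (2 : ℝ) H]
  exact (((h2.const_mul (H ^ 2)).comp_fst _).add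
    (((integrable_sqrt_noiseVar_mul hH h1 h2).const_mul (2 * H)).mul_prod
      (integrable_id_gaussianReal 0 1))).add
    ((integrable_noiseVar hH h1).mul_prod (integrable_id_sq_gaussianReal 0 1))

lemma integral_sq_snd_inputOutputLaw (hH : 0 < H) (h0 : ∀ᵐ x ∂μ, 0 ≤ x)
    (h1 : Integrable (fun x => x) μ) (h2 : Integrable (fun x => x ^ 2) μ) :
    ∫ y, y ^ 2 ∂(inputOutputLaw H σ ς μ).snd =
      H ^ 2 * ∫ x, x ^ 2 ∂μ + σ ^ 2 * (1 + H * ς ^ 2 * ∫ x, x ∂μ) := by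
  rw [integral_snd_inputOutputLaw hH h0 (by fun_prop)]
  simp_rw [sq_add_sqrt_mul, mul_pow, mul_assoc H, ← mul_assoc (2 : ℝ) H]
  have i1 := (h2.const_mul (H ^ 2)).comp_fst (gaussianReal 0 1)
  have i2 := ((integrable_sqrt_noiseVar_mul (σ := σ) (ς := ς) hH h1 h2).const_mul (2 * H)).mul_prod
      (integrable_id_gaussianReal 0 1)
  have i3 := (integrable_noiseVar (σ := σ) (ς := ς) hH h1).mul_prod
    (integrable_id_sq_gaussianReal 0 1)
  have i12 : Integrable (fun q : ℝ × ℝ => H ^ 2 * q.1 ^ 2 +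
      2 * H * (q.1 * √(noiseVar H σ ς q.1)) * q.2) (μ.prod (gaussianReal 0 1)) := i1.add i2
  rw [integral_add i12 i3, integral_add i1 i2, integral_fun_fst (fun x => H ^ 2 * x ^ 2),
    integral_prod_mul (fun x => 2 * H * (x * √(noiseVar H σ ς x))) (fun t => t),
    integral_prod_mul (fun x => (noiseVar H σ ς x : ℝ)) (fun t => t ^ 2),
    integral_id_gaussianReal, integral_id_sq_gaussianReal_zero_one, integral_const_mul,
    integral_noiseVar hH h0 h1]
  simp [mul_assoc]

end Moments

end Channel

end VLC

/-! ### Mutual information and the two output entropy bounds -/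

namespace VLC

open Set Filter Topology

variable {H σ ς : ℝ} {μ : Measure ℝ} [IsProbabilityMeasure μ]

lemma measurable_log_outputPDF : Measurable fun y => Real.log (outputPDF H σ ς μ y) :=
  measurable_outputPDF.log

lemma log_channelPDF (hH : 0 < H) (hσ : 0 < σ) (x y : ℝ) :
    Real.log (channelPDF H σ ς x y) =
      -(1 / 2) * (Real.log (2 * Real.pi) + Real.log (noiseVar H σ ς x)) -
        (y - H * x) ^ 2 / (2 * noiseVar H σ ς x) := by
  rw [channelPDF, log_gaussianPDFReal _ (noiseVar_ne_zero hH hσ x),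
    Real.log_mul (by positivity) (noiseVar_pos hH hσ x).ne']

lemma sq_sub_div_noiseVar_le (hH : 0 < H) (hσ : 0 < σ) (x y : ℝ) :
    (y - H * x) ^ 2 / (2 * noiseVar H σ ς x) ≤ (y ^ 2 + H ^ 2 * x ^ 2) / σ ^ 2 := by
  have hv := sq_le_noiseVar (σ := σ) (ς := ς) hH x
  have hv0 := noiseVar_pos (ς := ς) hH hσ x
  calc (y - H * x) ^ 2 / (2 * noiseVar H σ ς x)
      ≤ (2 * (y ^ 2 + H ^ 2 * x ^ 2)) / (2 * noiseVar H σ ς x) := by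
        gcongr
        nlinarith [sq_nonneg (y + H * x)]
    _ = (y ^ 2 + H ^ 2 * x ^ 2) / noiseVar H σ ς x := by field_simp
    _ ≤ _ := by gcongr

/-- A quadratic lower bound for the logarithm of the output density. -/
lemma le_log_outputPDF (hH : 0 < H) (hσ : 0 < σ) (h1 : Integrable (fun x => x) μ)
    (h2 : Integrable (fun x => x ^ 2) μ) (y : ℝ) :
    -(1 / 2) * (Real.log (2 * Real.pi) + ∫ x, Real.log (noiseVar H σ ς x) ∂μ) -
      (y ^ 2 + H ^ 2 * ∫ x, x ^ 2 ∂μ) / σ ^ 2 ≤ Real.log (outputPDF H σ ς μ y) := by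
  have hp := outputPDF_pos (μ := μ) (ς := ς) hH hσ y
  have il := integrable_log_noiseVar (ς := ς) hH hσ h1
  have ilc : Integrable (fun x => -(1 / 2) *
      (Real.log (2 * Real.pi) + Real.log (noiseVar H σ ς x))) μ :=
    ((integrable_const _).add il).const_mul _
  have iq : Integrable (fun x => (y ^ 2 + H ^ 2 * x ^ 2) / σ ^ 2) μ :=
    ((integrable_const _).add (h2.const_mul _)).div_const _
  have iq' : Integrable (fun x => (y - H * x) ^ 2 / (2 * noiseVar H σ ς x)) μ := by
    refine iq.mono' (Measurable.aestronglyMeasurable (by fun_prop)) (ae_of_all _ fun x => ?_)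
    rw [Real.norm_of_nonneg (by positivity)]
    exact sq_sub_div_noiseVar_le hH hσ x y
  have iG : Integrable (fun x => Real.log (channelPDF H σ ς x y)) μ := by
    simp_rw [log_channelPDF hH hσ]
    exact ilc.sub iq'
  -- With `y` fixed, Gibbs against a constant is Jensen's inequality: the log of the averaged
  -- density dominates the average of the logs.
  have key := integral_le_integral_of_lintegral_exp_sub_le_one
    (integrable_const (Real.log (outputPDF H σ ς μ y))) iG ?_
  · rw [integral_const, probReal_univ, one_smul] at key
    refine le_trans ?_ key
    simp_rw [log_channelPDF hH hσ]
    rw [integral_sub ilc iq', integral_const_mul, integral_add (integrable_const _) il]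
    have := integral_mono iq' iq fun x => sq_sub_div_noiseVar_le hH hσ x y
    rw [integral_div, integral_add (integrable_const _) (h2.const_mul _), integral_const_mul]
      at this
    simp only [integral_const, probReal_univ, one_smul] at this ⊢
    linarith
  · have : ∀ x, ENNReal.ofReal
        (Real.exp (Real.log (channelPDF H σ ς x y) - Real.log (outputPDF H σ ς μ y))) =
        ENNReal.ofReal (channelPDF H σ ς x y) * ENNReal.ofReal (outputPDF H σ ς μ y)⁻¹ := by
      intro x
      rw [Real.exp_sub, Real.exp_log (channelPDF_pos hH hσ x y), Real.exp_log hp,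
        ← ENNReal.ofReal_mul (channelPDF_pos hH hσ x y).le, div_eq_mul_inv]
    simp_rw [this]
    rw [lintegral_mul_const' _ _ ENNReal.ofReal_ne_top, ← ofReal_outputPDF hH hσ,
      ← ENNReal.ofReal_mul hp.le, mul_inv_cancel₀ hp.ne', ENNReal.ofReal_one]

/-- The log-density lies between a quadratic and a constant, and the output has a finite second
moment. -/
lemma integrable_log_outputPDF (hH : 0 < H) (hσ : 0 < σ) (h0 : ∀ᵐ x ∂μ, 0 ≤ x)
    (h1 : Integrable (fun x => x) μ) (h2 : Integrable (fun x => x ^ 2) μ) :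
    Integrable (fun y => Real.log (outputPDF H σ ς μ y)) (inputOutputLaw H σ ς μ).snd := by
  have i2 := integrable_sq_snd_inputOutputLaw (σ := σ) (ς := ς) hH h0 h1 h2
  set A := -(1 / 2) * (Real.log (2 * Real.pi) + ∫ x, Real.log (noiseVar H σ ς x) ∂μ)
  set B := H ^ 2 * ∫ x, x ^ 2 ∂μ
  set C := Real.log (√(2 * Real.pi * σ ^ 2))⁻¹
  have hI : Integrable (fun y => (|A| + |C|) + (y ^ 2 + |B|) / σ ^ 2)
      (inputOutputLaw H σ ς μ).snd :=
    (integrable_const _).add ((i2.add (integrable_const _)).div_const _)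
  refine hI.mono' measurable_log_outputPDF.aestronglyMeasurable (ae_of_all _ fun y => ?_)
  have hl : A - (y ^ 2 + B) / σ ^ 2 ≤ _ := le_log_outputPDF (ς := ς) hH hσ h1 h2 y
  have hu : _ ≤ C := Real.log_le_log (outputPDF_pos (ς := ς) (μ := μ) hH hσ y)
    (outputPDF_le hH hσ y)
  have hB : (y ^ 2 + B) / σ ^ 2 ≤ (y ^ 2 + |B|) / σ ^ 2 := by gcongr; exact le_abs_self B
  have hB0 : 0 ≤ (y ^ 2 + |B|) / σ ^ 2 := by positivity
  rw [Real.norm_eq_abs, abs_le]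
  constructor <;> linarith [neg_abs_le A, le_abs_self C, abs_nonneg A, abs_nonneg C]

lemma log_channelPDF_comp (hH : 0 < H) (hσ : 0 < σ) (x t : ℝ) :
    Real.log (channelPDF H σ ς x (H * x + √(noiseVar H σ ς x) * t)) =
      -(1 / 2) * (Real.log (2 * Real.pi) + Real.log (noiseVar H σ ς x)) - 1 / 2 * t ^ 2 := by
  have hv0 := noiseVar_pos (ς := ς) hH hσ x
  rw [log_channelPDF hH hσ, add_sub_cancel_left, mul_pow, Real.sq_sqrt hv0.le]
  field_simp

lemma integrable_log_channelPDF (hH : 0 < H) (hσ : 0 < σ) (h0 : ∀ᵐ x ∂μ, 0 ≤ x)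
    (h1 : Integrable (fun x => x) μ) :
    Integrable (fun q => Real.log (channelPDF H σ ς q.1 q.2)) (inputOutputLaw H σ ς μ) := by
  have hm : Measurable fun q : ℝ × ℝ => Real.log (channelPDF H σ ς q.1 q.2) :=
    measurable_uncurry_channelPDF.log
  rw [inputOutputLaw_eq_map hH h0, integrable_map_measure hm.aestronglyMeasurable (by fun_prop)]
  simp only [Function.comp_def, log_channelPDF_comp hH hσ]
  exact ((((integrable_const _).add (integrable_log_noiseVar hH hσ h1)).const_mul _).comp_fst
    _).sub (((integrable_id_sq_gaussianReal 0 1).const_mul _).comp_snd _)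

lemma integral_log_channelPDF (hH : 0 < H) (hσ : 0 < σ) (h0 : ∀ᵐ x ∂μ, 0 ≤ x)
    (h1 : Integrable (fun x => x) μ) :
    ∫ q, Real.log (channelPDF H σ ς q.1 q.2) ∂inputOutputLaw H σ ς μ =
      -(1 / 2) * (Real.log (2 * Real.pi) + ∫ x, Real.log (noiseVar H σ ς x) ∂μ) - 1 / 2 := by
  have hm : Measurable fun q : ℝ × ℝ => Real.log (channelPDF H σ ς q.1 q.2) :=
    measurable_uncurry_channelPDF.log
  have il := integrable_log_noiseVar (ς := ς) hH hσ h1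
  have ilc : Integrable (fun x => -(1 / 2) *
      (Real.log (2 * Real.pi) + Real.log (noiseVar H σ ς x))) μ :=
    ((integrable_const _).add il).const_mul _
  have i1 := ilc.comp_fst (gaussianReal 0 1)
  have i2 := ((integrable_id_sq_gaussianReal 0 1).const_mul (1 / 2)).comp_snd μ
  rw [inputOutputLaw_eq_map hH h0, integral_map (by fun_prop) hm.aestronglyMeasurable]
  simp only [log_channelPDF_comp hH hσ]
  refine (integral_sub i1 i2).trans ?_
  rw [integral_fun_fst (fun x => -(1 / 2) *
      (Real.log (2 * Real.pi) + Real.log (noiseVar H σ ς x))),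
    integral_fun_snd (fun t : ℝ => 1 / 2 * t ^ 2), integral_const_mul, integral_const_mul,
    integral_id_sq_gaussianReal_zero_one, integral_add (integrable_const _) il]
  simp

/-- The mutual information is the difference of the output and the noise entropies. -/
lemma coe_mutualInfo_inputOutputLaw (hH : 0 < H) (hσ : 0 < σ) (h0 : ∀ᵐ x ∂μ, 0 ≤ x)
    (h1 : Integrable (fun x => x) μ) (h2 : Integrable (fun x => x ^ 2) μ) :
    (mutualInfo (inputOutputLaw H σ ς μ) : EReal) =
      ((-(1 / 2) * (Real.log (2 * Real.pi) + ∫ x, Real.log (noiseVar H σ ς x) ∂μ) - 1 / 2 -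
        ∫ y, Real.log (outputPDF H σ ς μ y) ∂(inputOutputLaw H σ ς μ).snd : ℝ) : EReal) := by
  have hlog : ∀ q : ℝ × ℝ, Real.log (channelPDF H σ ς q.1 q.2 / outputPDF H σ ς μ q.2) =
      Real.log (channelPDF H σ ς q.1 q.2) - Real.log (outputPDF H σ ς μ q.2) := fun q =>
    Real.log_div (channelPDF_pos hH hσ _ _).ne' (outputPDF_pos hH hσ _).ne'
  have i1 := integrable_log_channelPDF (ς := ς) hH hσ h0 h1
  have i2 : Integrable (fun q : ℝ × ℝ => Real.log (outputPDF H σ ς μ q.2))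
      (inputOutputLaw H σ ς μ) :=
    (integrable_map_measure measurable_log_outputPDF.aestronglyMeasurable (by fun_prop)).1
      (integrable_log_outputPDF hH hσ h0 h1 h2)
  have hm : Measurable fun q : ℝ × ℝ => channelPDF H σ ς q.1 q.2 / outputPDF H σ ς μ q.2 :=
    measurable_uncurry_channelPDF.div (measurable_outputPDF.comp measurable_snd)
  rw [mutualInfo, fst_inputOutputLaw, coe_klDiv_withDensity hm
    (fun q => div_pos (channelPDF_pos hH hσ _ _) (outputPDF_pos hH hσ _))
    (inputOutputLaw_eq_withDensity_prod hH hσ h0)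
    (by simp_rw [hlog]; exact i1.sub i2)]
  simp_rw [hlog]
  rw [integral_sub i1 i2, integral_log_channelPDF hH hσ h0 h1, Measure.snd,
    integral_map (by fun_prop) measurable_log_outputPDF.aestronglyMeasurable]

/-- The output entropy is at most that of the Gaussian of the same variance. -/
lemma neg_log_variance_le_integral_log_outputPDF (hH : 0 < H) (hσ : 0 < σ) (h0 : ∀ᵐ x ∂μ, 0 ≤ x)
    (h1 : Integrable (fun x => x) μ) (h2 : Integrable (fun x => x ^ 2) μ) {V : ℝ} (hV : 0 < V)
    (hVeq : ∫ y, y ^ 2 ∂(inputOutputLaw H σ ς μ).snd - (H * ∫ x, x ∂μ) ^ 2 = V) :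
    -(1 / 2) * Real.log (2 * Real.pi * V) - 1 / 2 ≤
      ∫ y, Real.log (outputPDF H σ ς μ y) ∂(inputOutputLaw H σ ς μ).snd := by
  set M := H * ∫ x, x ∂μ
  have hv : V.toNNReal ≠ 0 := by simpa using hV
  have hvc : (V.toNNReal : ℝ) = V := Real.coe_toNNReal _ hV.le
  have i1 := integrable_id_snd_inputOutputLaw (σ := σ) (ς := ς) hH h0 h1
  have i2 := integrable_sq_snd_inputOutputLaw (σ := σ) (ς := ς) hH h0 h1 h2
  have e1 : ∫ y, y ∂(inputOutputLaw H σ ς μ).snd = M :=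
    integral_id_snd_inputOutputLaw (σ := σ) (ς := ς) hH h0 h1
  have hexp : ∀ y : ℝ, (y - M) ^ 2 / (2 * V) = (y ^ 2 - 2 * M * y + M ^ 2) / (2 * V) := fun y => by
    ring
  have i3 : Integrable (fun y => y ^ 2 - 2 * M * y) (inputOutputLaw H σ ς μ).snd :=
    i2.sub (i1.const_mul _)
  have iq : Integrable (fun y => (y - M) ^ 2 / (2 * V)) (inputOutputLaw H σ ς μ).snd := by
    simp_rw [hexp]
    exact (i3.add (integrable_const _)).div_const _
  have eq : ∫ y, (y - M) ^ 2 / (2 * V) ∂(inputOutputLaw H σ ς μ).snd = 1 / 2 := by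
    simp_rw [hexp]
    rw [integral_div, integral_add i3 (integrable_const _), integral_sub i2 (i1.const_mul _),
      integral_const_mul, e1]
    simp only [integral_const, probReal_univ, one_smul]
    field_simp
    linarith
  have iG : Integrable (fun y => Real.log (gaussianPDFReal M V.toNNReal y))
      (inputOutputLaw H σ ς μ).snd := by
    simp_rw [log_gaussianPDFReal M hv, hvc]
    exact (integrable_const _).sub iq
  -- Gibbs against the Gaussian density with the output's own mean and variance; its log-density has
  -- a mean that depends on these two moments alone.
  have key := integral_le_integral_of_lintegral_exp_sub_le_one
    (integrable_log_outputPDF (ς := ς) hH hσ h0 h1 h2) iG ?_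
  · refine le_of_eq_of_le ?_ key
    simp_rw [log_gaussianPDFReal M hv, hvc]
    rw [integral_sub (integrable_const _) iq, eq]
    simp
  · have hmp := measurable_outputPDF (H := H) (σ := σ) (ς := ς) (μ := μ)
    have hmg := measurable_gaussianPDFReal M V.toNNReal
    rw [snd_inputOutputLaw hH hσ h0, lintegral_withDensity_eq_lintegral_mul _ (by fun_prop)
      (by fun_prop), ← lintegral_gaussianPDFReal_eq_one M hv]
    refine lintegral_mono fun y => le_of_eq ?_
    have hp := outputPDF_pos (μ := μ) (ς := ς) hH hσ y
    have hg := gaussianPDFReal_pos M _ y hv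
    rw [Pi.mul_apply, ← ENNReal.ofReal_mul hp.le, Real.exp_sub, Real.exp_log hg,
      Real.exp_log hp, mul_div_cancel₀ _ hp.ne']

/-- The output law is the convolution of the law of the signal-dependent part and a Gaussian. -/
lemma snd_inputOutputLaw_eq_map_prod :
    (inputOutputLaw H σ ς μ).snd =
      (((μ.prod (gaussianReal 0 (ς ^ 2 * σ ^ 2).toNNReal)).map
        (fun q : ℝ × ℝ => H * q.1 + √(H * q.1) * q.2)).prod
          (gaussianReal 0 (σ ^ 2).toNNReal)).map (fun q => q.1 + q.2) := by
  rw [inputOutputLaw, Measure.snd_map_prodMk (by fun_prop), noiseLaw,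
    ← (measurePreserving_prodAssoc μ (gaussianReal 0 (ς ^ 2 * σ ^ 2).toNNReal)
      (gaussianReal 0 (σ ^ 2).toNNReal)).map_eq, Measure.map_map (by fun_prop) (by fun_prop)]
  have h := Measure.map_prod_map (μ.prod (gaussianReal 0 (ς ^ 2 * σ ^ 2).toNNReal))
    (gaussianReal 0 (σ ^ 2).toNNReal)
    (by fun_prop : Measurable fun q : ℝ × ℝ => H * q.1 + √(H * q.1) * q.2) measurable_id
  rw [Measure.map_id] at h
  rw [h, Measure.map_map (by fun_prop) (by fun_prop)]
  rfl

/-- Adding independent noise does not decrease the entropy. -/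
lemma integral_log_outputPDF_le (hH : 0 < H) (hσ : 0 < σ) (h0 : ∀ᵐ x ∂μ, 0 ≤ x)
    (h1 : Integrable (fun x => x) μ) (h2 : Integrable (fun x => x ^ 2) μ)
    {ν : Measure ℝ} [IsProbabilityMeasure ν]
    (hν : (μ.prod (gaussianReal 0 (ς ^ 2 * σ ^ 2).toNNReal)).map
        (fun q : ℝ × ℝ => H * q.1 + √(H * q.1) * q.2) = ν) {f : ℝ → ℝ} (hf : Measurable f)
    (hpos : ∀ y, 0 < f y) (hνf : ν = volume.withDensity fun y => ENNReal.ofReal (f y))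
    (hint : Integrable (fun y => Real.log (f y)) ν) :
    ∫ y, Real.log (outputPDF H σ ς μ y) ∂(inputOutputLaw H σ ς μ).snd ≤
      ∫ y, Real.log (f y) ∂ν := by
  have hsnd := snd_inputOutputLaw_eq_map_prod (H := H) (σ := σ) (ς := ς) (μ := μ)
  rw [hν] at hsnd
  have i1 := integrable_log_outputPDF (σ := σ) (ς := ς) hH hσ h0 h1 h2
  have hmp := measurable_outputPDF (H := H) (σ := σ) (ς := ς) (μ := μ)
  have hmass : ∫⁻ y, ENNReal.ofReal (outputPDF H σ ς μ y) = 1 := by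
    have := measure_univ (μ := (inputOutputLaw H σ ς μ).snd)
    rwa [snd_inputOutputLaw hH hσ h0, withDensity_apply _ MeasurableSet.univ,
      Measure.restrict_univ] at this
  rw [hsnd] at i1 ⊢
  rw [integrable_map_measure measurable_log_outputPDF.aestronglyMeasurable (by fun_prop)] at i1
  rw [integral_map (by fun_prop) measurable_log_outputPDF.aestronglyMeasurable]
  -- Gibbs under the joint law of signal part and noise, comparing `log f` at the signal part with
  -- the log output density at the sum. For each noise value `z` the exponential integrates to the
  -- mass of the output density translated by `z`, hence to one.
  have key := integral_le_integral_of_lintegral_exp_sub_le_one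
    (hint.comp_fst (gaussianReal 0 (σ ^ 2).toNNReal)) i1 ?_
  · rw [integral_fun_fst (fun y => Real.log (f y)), probReal_univ, one_smul] at key
    exact key
  · simp only [Function.comp_def]
    rw [lintegral_prod_symm _ (by fun_prop)]
    calc _ = ∫⁻ _, 1 ∂gaussianReal 0 (σ ^ 2).toNNReal := ?_
      _ ≤ 1 := by simp
    refine lintegral_congr fun z => ?_
    rw [← hmass,
      ← lintegral_add_right_eq_self (fun y => ENNReal.ofReal (outputPDF H σ ς μ y)) z, hνf,
      lintegral_withDensity_eq_lintegral_mul _ (by fun_prop) (by fun_prop)]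
    refine lintegral_congr fun y => ?_
    rw [Pi.mul_apply, ← ENNReal.ofReal_mul (hpos y).le, Real.exp_sub,
      Real.exp_log (outputPDF_pos hH hσ _), Real.exp_log (hpos y), mul_div_cancel₀ _ (hpos y).ne']

end VLC

/-! ### Evaluation at the exponential input and comparison with the closed form -/

namespace VLC

open Set Filter Topology

variable {H σ ς m : ℝ}

lemma expMeasure_mem_inputLawsWithDensity (hm : 0 < m) :
    expMeasure m⁻¹ ∈ inputLawsWithDensity m := by
  have hm' : 0 < m⁻¹ := inv_pos.2 hm
  refine ⟨⟨isProbabilityMeasure_expMeasure hm', (ae_expMeasure_pos _).mono fun x hx => hx.le, ?_,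
    ?_⟩, expMeasure_absolutelyContinuous _⟩
  · simpa using integrable_pow_expMeasure hm' 1
  · simpa using integral_pow_expMeasure hm' 1

lemma integral_log_noiseVar_expMeasure (hH : 0 < H) (hσ : 0 < σ) (hς : 0 < ς) (hm : 0 < m) :
    ∫ x, Real.log (noiseVar H σ ς x) ∂expMeasure m⁻¹ =
      Real.log (σ ^ 2) - Real.exp (1 / (H * ς ^ 2 * m)) * Ei (-(1 / (H * ς ^ 2 * m))) := by
  have hm' : 0 < m⁻¹ := inv_pos.2 hm
  have := isProbabilityMeasure_expMeasure hm'
  have hb : 0 < H * ς ^ 2 := by positivity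
  have h : ∀ᵐ x ∂expMeasure m⁻¹, Real.log (noiseVar H σ ς x) =
      Real.log (σ ^ 2) + Real.log (1 + H * ς ^ 2 * x) := by
    filter_upwards [ae_expMeasure_pos m⁻¹] with x hx
    rw [coe_noiseVar hH, abs_of_pos hx, Real.log_mul (by positivity) (by positivity)]
  have he : m⁻¹ / (H * ς ^ 2) = 1 / (H * ς ^ 2 * m) := by field_simp
  rw [integral_congr_ae h, integral_add (integrable_const _)
    (integrable_log_one_add_expMeasure hm' hb), integral_log_one_add_expMeasure hm' hb, he]
  simp [sub_eq_add_neg]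

/-- The exponential input of mean `m`: mutual information as a function of the output entropy. -/
lemma coe_mutualInfo_expMeasure (hH : 0 < H) (hσ : 0 < σ) (hς : 0 < ς) (hm : 0 < m) :
    (mutualInfo (inputOutputLaw H σ ς (expMeasure m⁻¹)) : EReal) =
      ((-(1 / 2) * (Real.log (2 * Real.pi) + Real.log (σ ^ 2) -
          Real.exp (1 / (H * ς ^ 2 * m)) * Ei (-(1 / (H * ς ^ 2 * m)))) - 1 / 2 -
        ∫ y, Real.log (outputPDF H σ ς (expMeasure m⁻¹) y)
          ∂(inputOutputLaw H σ ς (expMeasure m⁻¹)).snd : ℝ) : EReal) := by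
  have hm' : 0 < m⁻¹ := inv_pos.2 hm
  obtain ⟨⟨_, h0, h1, -⟩, -⟩ := expMeasure_mem_inputLawsWithDensity hm
  rw [coe_mutualInfo_inputOutputLaw hH hσ h0 h1 (integrable_pow_expMeasure hm' 2),
    integral_log_noiseVar_expMeasure hH hσ hς hm, add_sub_assoc]

lemma neg_log_variance_le_integral_log_outputPDF_expMeasure (hH : 0 < H) (hσ : 0 < σ)
    (hm : 0 < m) :
    -(1 / 2) * Real.log (2 * Real.pi * (H ^ 2 * m ^ 2 + H * m * ς ^ 2 * σ ^ 2 + σ ^ 2)) - 1 / 2 ≤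
      ∫ y, Real.log (outputPDF H σ ς (expMeasure m⁻¹) y)
        ∂(inputOutputLaw H σ ς (expMeasure m⁻¹)).snd := by
  have hm' : 0 < m⁻¹ := inv_pos.2 hm
  obtain ⟨⟨_, h0, h1, hmean⟩, -⟩ := expMeasure_mem_inputLawsWithDensity hm
  have h2 := integrable_pow_expMeasure hm' 2
  refine neg_log_variance_le_integral_log_outputPDF hH hσ h0 h1 h2 (by positivity) ?_
  rw [integral_sq_snd_inputOutputLaw hH h0 h1 h2, hmean, integral_pow_expMeasure hm' 2]
  simp only [Nat.factorial]
  push_cast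
  field_simp
  ring

/-- The exponential input: a lower bound for the output entropy. -/
lemma integral_log_outputPDF_expMeasure_le (hH : 0 < H) (hσ : 0 < σ) (hς : 0 < ς) (hm : 0 < m) :
    ∫ y, Real.log (outputPDF H σ ς (expMeasure m⁻¹) y)
        ∂(inputOutputLaw H σ ς (expMeasure m⁻¹)).snd ≤
      H * m / (ς ^ 2 * σ ^ 2) -
        H * m * √(1 + 2 * (ς ^ 2 * σ ^ 2) / (H * m)) / (ς ^ 2 * σ ^ 2) -
        Real.log (H * m * √(1 + 2 * (ς ^ 2 * σ ^ 2) / (H * m))) := by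
  have hm' : 0 < m⁻¹ := inv_pos.2 hm
  obtain ⟨⟨_, h0, h1, hmean⟩, -⟩ := expMeasure_mem_inputLawsWithDensity hm
  have h2 := integrable_pow_expMeasure hm' 2
  have hs : 0 < ς ^ 2 * σ ^ 2 := by positivity
  have ha : 0 < H * m := by positivity
  set s := ς ^ 2 * σ ^ 2
  set a := H * m
  have hlaw := map_expMeasure_prod_gaussianReal hH hm hs
  set ν := ((expMeasure m⁻¹).prod (gaussianReal 0 s.toNNReal)).map
        (fun q : ℝ × ℝ => H * q.1 + √(H * q.1) * q.2) with hν
  have : IsProbabilityMeasure ν := Measure.isProbabilityMeasure_map (by fun_prop)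
  have isq : Integrable (fun x => √(H * x)) (expMeasure m⁻¹) := by
    refine ((integrable_const 1).add (h1.const_mul H)).mono' (by fun_prop) ?_
    filter_upwards [h0] with x hx
    rw [Real.norm_of_nonneg (Real.sqrt_nonneg _), Pi.add_apply]
    nlinarith [Real.sq_sqrt (show 0 ≤ H * x by positivity), sq_nonneg (1 - √(H * x))]
  have j1 := (h1.const_mul H).comp_fst (gaussianReal 0 s.toNNReal)
  have j2 := isq.mul_prod (integrable_id_gaussianReal 0 s.toNNReal)
  have iy : Integrable (fun y => y) ν := by
    rw [hν, integrable_map_measure measurable_id'.aestronglyMeasurable (by fun_prop)]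
    exact j1.add j2
  have ey : ∫ y, y ∂ν = a := by
    rw [hν, integral_map (by fun_prop) measurable_id'.aestronglyMeasurable,
      integral_add j1 j2, integral_fun_fst (fun x => H * x),
      integral_prod_mul (fun x => √(H * x)) (fun t => t), integral_id_gaussianReal,
      integral_const_mul, hmean]
    simp [a]
  have k1 : Integrable (fun y => y / s) ν := iy.div_const s
  have k2 : Integrable (fun y => |y| * √(1 + 2 * s / a) / s) ν :=
    (iy.abs.mul_const _).div_const s
  have k3 : Integrable (fun y => y / s - |y| * √(1 + 2 * s / a) / s) ν := k1.sub k2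
  have ilog : Integrable (fun y => Real.log (laplacePDF a s y)) ν := by
    simp_rw [log_laplacePDF ha hs]
    exact k3.sub (integrable_const _)
  refine (integral_log_outputPDF_le hH hσ h0 h1 h2 hν.symm (measurable_laplacePDF a s)
    (laplacePDF_pos ha hs) hlaw ilog).trans ?_
  simp_rw [log_laplacePDF ha hs]
  rw [integral_sub k3 (integrable_const _), integral_sub k1 k2, integral_div, integral_div,
    integral_mul_const, ey]
  -- Beyond dropping `Z₀`, this is the only loss on the legitimate side: the absolute mean is
  -- replaced by the mean.
  have habs : a ≤ ∫ y, |y| ∂ν := by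
    rw [← ey]
    exact integral_mono iy iy.abs fun y => le_abs_self y
  simp only [integral_const, probReal_univ, one_smul]
  gcongr

/-- Pure algebra of logarithms. Here `hB` and `hE` stand for the mean log output densities, that is,
negated entropies. The constant `-1/2` left by the Gaussian bound appears in `cLow` as `1/2` from
the factor `e` and `-1` inside `fLow`. -/
lemma cLow_le_of_entropy_bounds {H_B σ_B ς_B H_E σ_E ς_E ξ P hB hE : ℝ}
    (hH_B : 0 < H_B) (hσ_B : 0 < σ_B) (hς_B : 0 < ς_B) (hH_E : 0 < H_E) (hσ_E : 0 < σ_E)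
    (hς_E : 0 < ς_E) (hξ : 0 < ξ) (hP : 0 < P)
    (hB_le : hB ≤ H_B * (ξ * P) / (ς_B ^ 2 * σ_B ^ 2) -
      H_B * (ξ * P) * √(1 + 2 * (ς_B ^ 2 * σ_B ^ 2) / (H_B * (ξ * P))) / (ς_B ^ 2 * σ_B ^ 2) -
      Real.log (H_B * (ξ * P) * √(1 + 2 * (ς_B ^ 2 * σ_B ^ 2) / (H_B * (ξ * P)))))
    (le_hE : -(1 / 2) * Real.log (2 * Real.pi *
      (H_E ^ 2 * (ξ * P) ^ 2 + H_E * (ξ * P) * ς_E ^ 2 * σ_E ^ 2 + σ_E ^ 2)) - 1 / 2 ≤ hE) :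
    cLow H_B σ_B ς_B H_E σ_E ς_E ξ P ≤
      (-(1 / 2) * (Real.log (2 * Real.pi) + Real.log (σ_B ^ 2) -
        Real.exp (1 / (H_B * ς_B ^ 2 * (ξ * P))) * Ei (-(1 / (H_B * ς_B ^ 2 * (ξ * P))))) -
          1 / 2 - hB) -
      (-(1 / 2) * (Real.log (2 * Real.pi) + Real.log (σ_E ^ 2) -
        Real.exp (1 / (H_E * ς_E ^ 2 * (ξ * P))) * Ei (-(1 / (H_E * ς_E ^ 2 * (ξ * P))))) -
          1 / 2 - hE) := by
  rw [cLow, fLow]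
  simp only [mul_assoc _ ξ P, ← mul_pow ξ P, mul_assoc _ (ξ ^ 2) (P ^ 2)]
  have hm : 0 < ξ * P := by positivity
  generalize ξ * P = m at *
  have hs : 0 < ς_B ^ 2 * σ_B ^ 2 := by positivity
  have hVpos : 0 < H_E ^ 2 * m ^ 2 + H_E * m * ς_E ^ 2 * σ_E ^ 2 + σ_E ^ 2 := by positivity
  have ha : 0 < H_B * m := by positivity
  have e1 : H_B * m * √(1 + 2 * (ς_B ^ 2 * σ_B ^ 2) / (H_B * m)) =
      √(H_B * m * (H_B * m + 2 * ς_B ^ 2 * σ_B ^ 2)) := by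
    rw [← Real.sqrt_sq ha.le, ← Real.sqrt_mul (by positivity), Real.sqrt_sq ha.le]
    congr 1
    field_simp
  have e2 : Real.log √(H_B * m * (H_B * m + 2 * ς_B ^ 2 * σ_B ^ 2)) =
      Real.log m + 1 / 2 * Real.log (H_B ^ 2 + 2 * H_B * ς_B ^ 2 * σ_B ^ 2 / m) := by
    have : H_B * m * (H_B * m + 2 * ς_B ^ 2 * σ_B ^ 2) =
        m ^ 2 * (H_B ^ 2 + 2 * H_B * ς_B ^ 2 * σ_B ^ 2 / m) := by field_simp
    rw [Real.log_sqrt (by positivity), this, Real.log_mul (by positivity) (by positivity),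
      Real.log_pow]
    push_cast; ring
  have e3 : (H_B * m + ς_B ^ 2 * σ_B ^ 2) / (ς_B ^ 2 * σ_B ^ 2) =
      H_B * m / (ς_B ^ 2 * σ_B ^ 2) + 1 := by field_simp
  rw [e1, e2] at hB_le
  rw [Real.log_mul (by positivity) hVpos.ne'] at le_hE
  rw [e3, Real.log_div (by positivity) (by positivity), Real.log_mul (by positivity) hVpos.ne',
    Real.log_mul (by positivity) (by positivity), Real.log_mul (by positivity) (by positivity),
    Real.log_mul (by positivity) (by positivity), Real.log_exp, Real.log_pow m]
  push_cast
  linarith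

end VLC

theorem theorem1 (H_B σ_B ς_B H_E σ_E ς_E ξ P : ℝ)
    (hH_B : 0 < H_B) (hσ_B : 0 < σ_B) (hς_B : 0 < ς_B)
    (hH_E : 0 < H_E) (hσ_E : 0 < σ_E) (hς_E : 0 < ς_E)
    (hξ : ξ ∈ Set.Ioc (0 : ℝ) 1) (hP : 0 < P) :
    ((VLC.cLow H_B σ_B ς_B H_E σ_E ς_E ξ P : ℝ) : EReal)
        ≤ VLC.secrecyCapacity H_B σ_B ς_B H_E σ_E ς_E (ξ * P)
      ∧ ((VLC.cLow H_B σ_B ς_B H_E σ_E ς_E ξ P : ℝ) : EReal)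
        ≤ VLC.maxSecrecyRate H_B σ_B ς_B H_E σ_E ς_E (VLC.inputLawsWithDensity (ξ * P)) := by
  have hm : 0 < ξ * P := mul_pos hξ.1 hP
  have key : ((VLC.cLow H_B σ_B ς_B H_E σ_E ς_E ξ P : ℝ) : EReal) ≤
      (VLC.mutualInfo (VLC.inputOutputLaw H_B σ_B ς_B (expMeasure (ξ * P)⁻¹)) : EReal) -
        (VLC.mutualInfo (VLC.inputOutputLaw H_E σ_E ς_E (expMeasure (ξ * P)⁻¹)) : EReal) := by
    rw [VLC.coe_mutualInfo_expMeasure hH_B hσ_B hς_B hm,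
      VLC.coe_mutualInfo_expMeasure hH_E hσ_E hς_E hm, ← EReal.coe_sub, EReal.coe_le_coe_iff]
    exact VLC.cLow_le_of_entropy_bounds hH_B hσ_B hς_B hH_E hσ_E hς_E hξ.1 hP
      (VLC.integral_log_outputPDF_expMeasure_le hH_B hσ_B hς_B hm)
      (VLC.neg_log_variance_le_integral_log_outputPDF_expMeasure hH_E hσ_E hm)
  have hmem := VLC.expMeasure_mem_inputLawsWithDensity hm
  exact ⟨le_iSup₂_of_le _ hmem.1 key, le_iSup₂_of_le _ hmem key⟩
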